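/- Let $V$ be a finite-dimensional real vector space, let $\mathcal A$ be a finite set of affine hyperplanes in $V$, and let $m\ge 1$. For each $H\in\mathcal A$, with equation $\alpha(x)=c$, where $\alpha\in V^*\setminus\{0\}$ and $c\in\mathbb R$, put $v_H=(\alpha,-c)\in V^*\times\mathbb R$ (well defined up to a nonzero scalar). Let $M_{\mathcal A}$ be the matroid on $\mathcal A$ in which a set of hyperplanes is independent if and only if the corresponding vectors $v_H$ are linearly independent. Let $D_m M_{\mathcal A}$ be its $m$-th Dilworth truncation, i.e. the matroid on the set $\binom{\mathcal A}{m+1}$ of $(m+1)$-element subsets of $\mathcal A$ whose independent sets are the $I\subseteq\binom{\mathcal A}{m+1}$ with $$\operatorname{rank}_{M_{\mathcal A}}\Bigl(\bigcup_{S\in I'}S\Bigr)\ \ge\ \#I'+m\qquad\text{for all } \emptyset\ne I'\subseteq I .$$ For points $p_1,\dots,p_m\in V$, let the generalized valid order arrangement $\mathrm{vo}(\mathcal A;p_1,\dots,p_m)$ be the set of all affine hyperplanes $K$ of $V$ that contain $p_1,\dots,p_m$ and pass through the intersection of some $m+1$ distinct hyperplanes $H_0,\dots,H_m$ of $\mathcal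 A$, including the intersection at infinity. The last condition means that $\bigcap_i\widehat H_i\subseteq\widehat K$, where for a hyperplane $H=\{x:\alpha(x)=c\}$ we write $\widehat H=\{(x,y)\in V\times\mathbb R:\alpha(x)=cy\}$ (the projective closure of $H$ in homogeneous coordinates). **Theorem.** If $p_1,\dots,p_m$ are sufficiently generic, then the intersection lattice of $\mathrm{vo}(\mathcal A;p_1,\dots,p_m)$ (all nonempty intersections of its hyperplanes, including $V$ as the empty intersection, ordered by reverse inclusion) is isomorphic, as a partially ordered set, to the lattice of flats of $D_mM_{\mathcal A}$ (ordered by inclusion). Here "sufficiently generic" means: there is a nonzero real polynomial $P$ in the coordinates of $m$ points of $V$, depending only on $\mathcal A$ and $m$, such that the statement holds for all $(p_1,\dots,p_m)\in V^m$ with $P(p_1,\dots,p_m)\neq 0$. -/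

import Mathlib

noncomputable section

namespace ValidOrder

/-! ### Linear matroids -/

/-- The linear matroid on a ground set `E` represented by a family of vectors `v`: a subset `I` of
`E` is independent if the vectors `v e`, `e ∈ I`, are linearly independent. -/
def linearMatroid {K W ι : Type*} [Field K] [AddCommGroup W] [Module K W]
    (v : ι → W) (E : Set ι) : Matroid ι :=
  (IndepMatroid.ofFinitaryCardAugment E (fun I => I ⊆ E ∧ LinearIndepOn K v I)
    ⟨Set.empty_subset _, linearIndepOn_empty K v⟩
    (fun _ _ hJ h => ⟨h.trans hJ.1, hJ.2.mono h⟩)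
    (by
      intro I J hI hIf hJ hJf hlt
      by_contra! hcon
      have hspan : ∀ e ∈ J, v e ∈ Submodule.span K (v '' I) := by
        intro e he
        by_contra hv
        have heI : e ∉ I := fun h => hv (Submodule.subset_span ⟨e, h, rfl⟩)
        exact hcon e he heI (Set.insert_subset (hJ.1 he) hI.1) (hI.2.insert hv)
      have hle : Submodule.span K (v '' J) ≤ Submodule.span K (v '' I) := by
        rw [Submodule.span_le]
        rintro _ ⟨e, he, rfl⟩
        exact hspan e he
      have hrank : ∀ S : Set ι, S.Finite → LinearIndepOn K v S →
          Module.finrank K (Submodule.span K (v '' S)) = S.ncard := by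
        intro S hS h
        let _ := hS.fintype
        have h1 := finrank_span_eq_card h
        rw [Set.ncard_eq_toFinset_card', Set.toFinset_card, ← h1, Set.image_eq_range]
      have : Module.Finite K (Submodule.span K (v '' I)) :=
        FiniteDimensional.span_of_finite K (hIf.image v)
      have := Submodule.finrank_mono hle
      rw [hrank I hIf hI.2, hrank J hJf hJ.2] at this
      omega)
    (by
      intro I h
      refine ⟨fun e he => (h {e} (by simpa using he) (Set.finite_singleton e)).1 rfl, ?_⟩
      rw [linearIndepOn_iff_linearIndepOn_finset]
      intro s hs
      exact (h s hs s.finite_toSet).2)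
    (fun _ h => h.1)).matroid

/-! ### Dilworth truncations -/

/-- Matroid augmentation for the independent sets defined by `f T - k`, where `f` is monotone and
submodular. -/
theorem exists_augment {β : Type*} [DecidableEq β] (f : Finset β → ℕ) (k : ℕ)
    (mono : ∀ S T, S ⊆ T → f S ≤ f T)
    (submod : ∀ S T, f (S ∩ T) + f (S ∪ T) ≤ f S + f T) (I J : Finset β)
    (hI : ∀ T ⊆ I, T.Nonempty → T.card + k ≤ f T)
    (hJ : ∀ T ⊆ J, T.Nonempty → T.card + k ≤ f T) (hlt : I.card < J.card) :
    ∃ e ∈ J, e ∉ I ∧ ∀ T ⊆ insert e I, T.Nonempty → T.card + k ≤ f T := by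
  classical
  by_contra! hcon
  let tight : Finset β → Prop := fun S => S ⊆ I ∧ S.Nonempty ∧ f S = S.card + k
  have hunion : ∀ S T, tight S → tight T → (S ∩ T).Nonempty → tight (S ∪ T) := by
    rintro S T ⟨hS, hS', hSf⟩ ⟨hT, hT', hTf⟩ hne
    refine ⟨Finset.union_subset hS hT, hS'.mono Finset.subset_union_left, ?_⟩
    have h1 := hI (S ∩ T) (Finset.inter_subset_left.trans hS) hne
    have h2 := hI (S ∪ T) (Finset.union_subset hS hT) (hS'.mono Finset.subset_union_left)
    have h3 := submod S T
    have h4 := Finset.card_inter_add_card_union S T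
    omega
  -- adding to a larger set an element that does not increase `f` on a smaller one
  have hext : ∀ S T e, S ⊆ T → f (insert e S) = f S → f (insert e T) = f T := by
    intro S T e hST he
    have h1 := submod (insert e S) T
    have h2 := mono S (insert e S ∩ T)
      (Finset.subset_inter (Finset.subset_insert _ _) hST)
    have h3 : insert e S ∪ T = insert e T := by
      rw [Finset.insert_union, Finset.union_eq_right.2 hST]
    rw [h3] at h1
    have h4 := mono T (insert e T) (Finset.subset_insert _ _)
    omega
  let 𝓜 := I.powerset.filter (fun S => Maximal tight S)
  have hmem : ∀ S, S ∈ 𝓜 ↔ Maximal tight S := by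
    intro S
    simp only [𝓜, Finset.mem_filter, Finset.mem_powerset, and_iff_right_iff_imp]
    exact fun h => h.prop.1
  have hmax : ∀ S, tight S → ∃ S' ∈ 𝓜, S ⊆ S' := by
    intro S hS
    have hfin : {T | tight T}.Finite :=
      I.powerset.finite_toSet.subset (fun T hT => by simpa using hT.1)
    obtain ⟨S', hSS', hS'⟩ := hfin.exists_le_maximal hS
    exact ⟨S', (hmem _).2 hS', hSS'⟩
  have hdisj : ∀ S ∈ 𝓜, ∀ T ∈ 𝓜, S ≠ T → Disjoint S T := by
    intro S hS T hT hne
    rw [hmem] at hS hT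
    by_contra hd
    have hu := hunion S T hS.prop hT.prop (Finset.not_disjoint_iff_nonempty_inter.1 hd)
    exact hne ((hS.eq_of_le hu Finset.subset_union_left).trans
      (hT.eq_of_le hu Finset.subset_union_right).symm)
  let C : Finset β → Finset β := fun S => J.filter (fun e => f (insert e S) = f S)
  have hC : ∀ S ∈ 𝓜, (C S).card ≤ S.card := by
    intro S hS
    rw [hmem] at hS
    have hgen : ∀ D : Finset β, D ⊆ C S → f (S ∪ D) = f S := by
      intro D
      induction D using Finset.induction_on with
      | empty => simp
      | insert e D _ ih =>
        intro hD
        have h1 := ih ((Finset.subset_insert _ _).trans hD)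
        have h2 := (Finset.mem_filter.1 (hD (Finset.mem_insert_self e D))).2
        rw [Finset.union_insert, hext S (S ∪ D) e Finset.subset_union_left h2, h1]
    rcases (C S).eq_empty_or_nonempty with h | h
    · simp [h]
    · have h1 := hJ (C S) (Finset.filter_subset _ _) h
      have h2 := mono (C S) (S ∪ C S) Finset.subset_union_right
      have h3 := hgen (C S) subset_rfl
      have h4 := hS.prop.2.2
      omega
  have hcover : J ⊆ 𝓜.biUnion C ∪ (I \ 𝓜.biUnion id) := by
    intro e he
    by_cases heI : e ∈ I
    · by_cases h : ∃ S ∈ 𝓜, e ∈ S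
      · obtain ⟨S, hS, heS⟩ := h
        refine Finset.mem_union_left _ (Finset.mem_biUnion.2 ⟨S, hS, ?_⟩)
        exact Finset.mem_filter.2 ⟨he, by rw [Finset.insert_eq_of_mem heS]⟩
      · refine Finset.mem_union_right _ (Finset.mem_sdiff.2 ⟨heI, ?_⟩)
        simpa using h
    · obtain ⟨T, hT, hTne, hTf⟩ := hcon e he heI
      have heT : e ∈ T := by
        by_contra h
        have := hI T ((Finset.subset_insert_iff_of_notMem h).1 hT) hTne
        omega
      have hSI : T.erase e ⊆ I := Finset.subset_insert_iff.1 hT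
      have hins : insert e (T.erase e) = T := Finset.insert_erase heT
      have hcard := Finset.card_erase_add_one heT
      have hSne : (T.erase e).Nonempty := by
        by_contra h
        rw [Finset.not_nonempty_iff_eq_empty] at h
        have := hJ T (by rw [← hins, h]; simpa using he) hTne
        omega
      have h1 := hI _ hSI hSne
      have h2 := mono (T.erase e) T (Finset.erase_subset _ _)
      obtain ⟨S', hS', hSS'⟩ := hmax (T.erase e) ⟨hSI, hSne, by omega⟩
      refine Finset.mem_union_left _ (Finset.mem_biUnion.2 ⟨S', hS', ?_⟩)
      exact Finset.mem_filter.2 ⟨he, hext _ S' e hSS' (by rw [hins]; omega)⟩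
  have h1 := Finset.card_le_card hcover
  have h2 := Finset.card_union_le (𝓜.biUnion C) (I \ 𝓜.biUnion id)
  have h3 : (𝓜.biUnion C).card ≤ ∑ S ∈ 𝓜, S.card :=
    Finset.card_biUnion_le.trans (Finset.sum_le_sum hC)
  have h4 : (𝓜.biUnion id).card = ∑ S ∈ 𝓜, S.card :=
    Finset.card_biUnion (fun S hS T hT hne => hdisj S hS T hT hne)
  have h5 : 𝓜.biUnion id ⊆ I := by
    intro x hx
    obtain ⟨S, hS, hxS⟩ := Finset.mem_biUnion.1 hx
    exact ((hmem S).1 hS).prop.1 hxS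
  have h6 := Finset.card_sdiff_add_card_eq_card h5
  omega

/-- The family `I` of sets satisfies `rank_M (⋃ I') ≥ #I' + k` for all finite nonempty
`I' ⊆ I`. -/
def DilworthCondition {α : Type*} (M : Matroid α) (k : ℕ) (I : Set (Finset α)) : Prop :=
  ∀ I' : Finset (Finset α), (I' : Set (Finset α)) ⊆ I → I'.Nonempty →
    ((I'.card + k : ℕ) : ℕ∞) ≤ M.eRk (⋃ s ∈ I', (s : Set α))

open Classical in
theorem DilworthCondition.augment {α : Type*} (M : Matroid α) (k : ℕ) (I J : Finset (Finset α))
    (hI : DilworthCondition M k I) (hJ : DilworthCondition M k J) (hlt : I.card < J.card) :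
    ∃ e ∈ J, e ∉ I ∧ DilworthCondition M k (insert e (I : Set (Finset α))) := by
  let U : Finset (Finset α) → Set α := fun T => ⋃ s ∈ T, (s : Set α)
  have hU : ∀ T, (((M.eRk (U T)).toNat : ℕ) : ℕ∞) = M.eRk (U T) := by
    intro T
    apply ENat.natCast_toNat
    rw [Matroid.eRk_ne_top_iff]
    exact M.isRkFinite_of_finite (T.finite_toSet.biUnion (fun s _ => s.finite_toSet))
  have key : ∀ T (n : ℕ), (n : ℕ∞) ≤ M.eRk (U T) ↔ n ≤ (M.eRk (U T)).toNat := by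
    intro T n
    rw [← hU T, ENat.toNat_natCast, Nat.cast_le]
  have hmono : ∀ S T, S ⊆ T → (M.eRk (U S)).toNat ≤ (M.eRk (U T)).toNat := by
    intro S T h
    rw [← key, hU]
    exact M.eRk_mono (Set.biUnion_subset_biUnion_left h)
  obtain ⟨e, heJ, heI, h⟩ := exists_augment (fun T => (M.eRk (U T)).toNat) k hmono
    (by
      intro S T
      have h1 := M.eRk_inter_add_eRk_union_le (U S) (U T)
      have h2 : U (S ∪ T) = U S ∪ U T := Finset.set_biUnion_union S T _
      have h3 : M.eRk (U (S ∩ T)) ≤ M.eRk (U S ∩ U T) := M.eRk_mono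
        (Set.subset_inter (Set.biUnion_subset_biUnion_left Finset.inter_subset_left)
          (Set.biUnion_subset_biUnion_left Finset.inter_subset_right))
      rw [← h2] at h1
      have h4 := (add_le_add_left h3 (M.eRk (U (S ∪ T)))).trans h1
      rw [← hU (S ∩ T), ← hU (S ∪ T), ← hU S, ← hU T] at h4
      exact_mod_cast h4)
    I J
    (fun T hT hne => (key T _).1 (hI T (by exact_mod_cast hT) hne))
    (fun T hT hne => (key T _).1 (hJ T (by exact_mod_cast hT) hne)) hlt
  exact ⟨e, heJ, heI, fun T hT hne => (key T _).2 (h T (by exact_mod_cast hT) hne)⟩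

/-- The `k`-th Dilworth truncation `D_k M` of a matroid `M`: its ground set consists of the
`(k + 1)`-element subsets of the ground set of `M`, and a set `I` of these is independent if
`rank_M (⋃ I') ≥ #I' + k` for all (finite) nonempty `I' ⊆ I`. -/
def dilworthTruncation {α : Type*} (k : ℕ) (M : Matroid α) : Matroid (Finset α) :=
  (IndepMatroid.ofFinitaryCardAugment {s : Finset α | (s : Set α) ⊆ M.E ∧ s.card = k + 1}
    (fun I => I ⊆ {s : Finset α | (s : Set α) ⊆ M.E ∧ s.card = k + 1} ∧ DilworthCondition M k I)
    ⟨Set.empty_subset _, fun I' h hne => by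
      obtain ⟨x, hx⟩ := hne
      exact absurd (h hx) (Set.notMem_empty x)⟩
    (fun _ _ hJ h => ⟨h.trans hJ.1, fun I' hI' => hJ.2 I' (hI'.trans h)⟩)
    (by
      intro I J hI hIf hJ hJf hlt
      lift I to Finset (Finset α) using hIf
      lift J to Finset (Finset α) using hJf
      rw [Set.ncard_coe_finset, Set.ncard_coe_finset] at hlt
      obtain ⟨e, heJ, heI, h⟩ := DilworthCondition.augment M k I J hI.2 hJ.2 hlt
      exact ⟨e, heJ, by simpa using heI, Set.insert_subset (hJ.1 heJ) hI.1, h⟩)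
    (by
      intro I h
      exact ⟨fun s hs => (h {s} (by simpa using hs) (Set.finite_singleton s)).1 rfl,
        fun I' hI' hne => (h I' hI' I'.finite_toSet).2 I' subset_rfl hne⟩)
    (fun _ h => h.1)).matroid

/-- The lattice of flats `L_M` of a matroid, ordered by inclusion. -/
abbrev LatticeOfFlats {α : Type*} (M : Matroid α) : Type _ := {F : Set α // M.IsFlat F}

/-! ### Hyperplane arrangements -/

variable {V : Type*} [AddCommGroup V] [Module ℝ V]

/-- `H` is defined by the equation `α x = c`, with `α ≠ 0`. -/
def HasEquation (H : AffineSubspace ℝ V) (α : Module.Dual ℝ V) (c : ℝ) : Prop :=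
  α ≠ 0 ∧ ∀ x, x ∈ H ↔ α x = c

/-- An affine hyperplane of `V`. -/
def IsHyperplane (H : AffineSubspace ℝ V) : Prop :=
  ∃ (α : Module.Dual ℝ V) (c : ℝ), HasEquation H α c

open Classical in
/-- The vector `v_H = (α, -c)` associated with a hyperplane `H` that has the equation `α x = c`.
It is well defined up to a nonzero scalar, and one choice is made here (the value is `0` if `H` is
not a hyperplane). -/
def normalVec (H : AffineSubspace ℝ V) : Module.Dual ℝ V × ℝ :=
  if h : IsHyperplane H then (h.choose, -h.choose_spec.choose) else 0

/-- The matroid `M_A` of an arrangement `A`: the linear matroid of the vectors `v_H`, `H ∈ A`. -/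
def arrangementMatroid (A : Finset (AffineSubspace ℝ V)) : Matroid (AffineSubspace ℝ V) :=
  linearMatroid (K := ℝ) normalVec (A : Set (AffineSubspace ℝ V))

/-- The semicone over `H`: if `H` is the hyperplane `α x = c`, then this is the linear hyperplane
`α x = c y` in the space `V × ℝ` of pairs `(x, y)`. Its points with `y = 1` are those of `H`, and
its points with `y = 0` form the direction of `H`, so that the lines in it are the points of the
projective closure of `H`, including those at infinity. -/
def semicone (H : AffineSubspace ℝ V) : Submodule ℝ (V × ℝ) :=
  LinearMap.ker ((normalVec H).1.coprod ((normalVec H).2 • LinearMap.id))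

theorem hasEquation_normalVec {H : AffineSubspace ℝ V} (h : IsHyperplane H) :
    HasEquation H (normalVec H).1 (-(normalVec H).2) := by
  simp only [normalVec, dif_pos h, neg_neg]
  exact h.choose_spec.choose_spec

/-- The semicone depends only on the hyperplane, not on the chosen equation. -/
theorem mem_semicone_iff {H : AffineSubspace ℝ V} {α : Module.Dual ℝ V} {c : ℝ}
    (h : HasEquation H α c) (x : V) (y : ℝ) : (x, y) ∈ semicone H ↔ α x = c * y := by
  obtain ⟨hα', hH'⟩ := hasEquation_normalVec ⟨α, c, h⟩
  obtain ⟨hα, hH⟩ := h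
  set β := (normalVec H).1
  set e := (normalVec H).2
  have hmem : (x, y) ∈ semicone H ↔ β x + e * y = 0 := by
    simp [semicone, β, e]
  rw [hmem]
  have heq : ∀ z, α z = c ↔ β z = -e := fun z => (hH z).symm.trans (hH' z)
  obtain ⟨u, hu⟩ : ∃ u, α u ≠ 0 := by
    by_contra! h0
    exact hα (LinearMap.ext h0)
  obtain ⟨w, hw⟩ : ∃ w, α w = c := ⟨(c / α u) • u, by simp [hu]⟩
  have hw' : β w = -e := (heq w).1 hw
  have hdir : ∀ z, α z = 0 ↔ β z = 0 := by
    intro z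
    have := heq (w + z)
    rw [map_add, map_add, hw, hw'] at this
    simpa using this
  have := hdir (x - y • w)
  rw [map_sub, map_sub, map_smul, map_smul, hw, hw', smul_eq_mul, smul_eq_mul] at this
  constructor
  · intro h
    have := this.2 (by linarith)
    linarith
  · intro h
    have := this.1 (by linarith)
    linarith

/-- The hyperplane `K` passes through the intersection of the hyperplanes in `S`, including the
intersection at infinity: in the projective closure of `V`, the intersection of (the closures of)
the hyperplanes in `S` is contained in `K`. -/
def PassesThroughInter (K : AffineSubspace ℝ V) (S : Finset (AffineSubspace ℝ V)) : Prop :=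
  ⨅ H ∈ S, semicone H ≤ semicone K

/-- The generalized valid order arrangement `vo(A; p₁, …, p_m)`: all hyperplanes that pass through
`p₁, …, p_m` and through an intersection of `m + 1` hyperplanes of `A`, including intersections at
infinity. -/
def vo (A : Finset (AffineSubspace ℝ V)) {m : ℕ} (p : Fin m → V) : Set (AffineSubspace ℝ V) :=
  {K | IsHyperplane K ∧ (∀ i, p i ∈ K) ∧
    ∃ S ⊆ A, S.card = m + 1 ∧ PassesThroughInter K S}

/-- The intersection lattice of an arrangement: all nonempty intersections of subfamilies,
including the whole space as the empty intersection, ordered by reverse inclusion. -/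
abbrev IntersectionLattice (B : Set (AffineSubspace ℝ V)) : Type _ :=
  {X : AffineSubspace ℝ V // X ≠ ⊥ ∧ ∃ C ⊆ B, X = sInf C}ᵒᵈ

/-- The property `Q` holds for sufficiently generic `m`-tuples of points of `V`: there is a nonzero
polynomial in the coordinates of the `m` points such that `Q` holds for all tuples at which it does
not vanish. (This does not depend on the basis that defines the coordinates.) -/
def ForGenericPoints [FiniteDimensional ℝ V] (m : ℕ) (Q : (Fin m → V) → Prop) : Prop :=
  ∃ P : MvPolynomial (Fin m × Fin (Module.finrank ℝ V)) ℝ, P ≠ 0 ∧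
    ∀ p : Fin m → V,
      MvPolynomial.eval (fun ij => (Module.finBasis ℝ V).repr (p ij.1) ij.2) P ≠ 0 → Q p

end ValidOrder

end

/-! Elements `φ` of `V* × ℝ` are affine functions `x ↦ φ.1 x + φ.2` on `V`. A hyperplane lies in `vo
A p` exactly when, for some `(m + 1)`-set `S`, its normal vector is in the span `U_S` of the `v_H`,
`H ∈ S`, and vanishes at all `p k`. For generic `p` this intersection is spanned by one vector `y S`
(possibly zero), so the arrangement consists of the zero sets of the nonzero `y S`. They all pass
through `p 0`, so intersections correspond to flats of the linear matroid of the `y S`. It remains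
to see that `y` represents the Dilworth truncation (`exists_dilworthTruncation_eq_linearMatroid`).

If the `y S`, `S ∈ I'`, are independent, they lie in the functions of `span (⋃ I')` vanishing at
`p`, a space of dimension rank minus `m` for generic `p`. This gives the Dilworth inequality.

Conversely, under the Dilworth condition, independence is the nonvanishing of a polynomial in `p`,
so one good tuple suffices (`ForGenericPoints.of_exists`). To find it (`exists_points_independent`),
a Rado-type argument (`exists_transversal`) chooses independent `w S ∈ U_S` whose span `X` avoids
the constant function `(0, 1)` and meets each `U_S` only in the line of `w S`. Then
`exists_functionals` gives `m` functionals whose common zeros in each `U_S` lie in `X`. Being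
nonzero at `(0, 1)`, they are evaluations at points up to scaling, and at these points `y S` is
forced onto the line of `w S`. -/

noncomputable section

namespace ValidOrder

open Module

/-! ### Linear algebra over infinite fields: independent transversals and generic functionals -/

section Transversal

variable {K W ι κ : Type*} [Field K] [AddCommGroup W] [Module K W]

/-- A subspace over an infinite field is not covered by finitely many subspaces that do not
contain it. -/
theorem exists_mem_forall_notMem [Infinite K] (U : Submodule K W) {s : Set (Submodule K W)} (hs : s.Finite)
    (h : ∀ P ∈ s, ¬ U ≤ P) : ∃ w ∈ U, ∀ P ∈ s, w ∉ P := by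
  classical
  have hfin := hs.image (fun P => P.comap U.subtype)
  have hne := Subspace.biUnion_ne_univ_of_top_notMem (s := hfin.toFinset) (k := K) (E := U) (by
    simp only [Set.Finite.mem_toFinset, Set.mem_image, not_exists, not_and]
    intro P hP htop
    exact h P hP (Submodule.comap_subtype_eq_top.1 htop))
  obtain ⟨⟨w, hw⟩, hw'⟩ := (Set.ne_univ_iff_exists_notMem _).1 hne
  refine ⟨w, hw, fun P hP hwP => hw' ?_⟩
  simp only [Set.Finite.mem_toFinset, Set.mem_iUnion]
  exact ⟨_, ⟨P, hP, rfl⟩, hwP⟩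

theorem finrank_lt_sup_span_singleton [FiniteDimensional K W] {P : Submodule K W} {w : W}
    (hw : w ∉ P) : finrank K P + 1 ≤ finrank K ↥(P ⊔ K ∙ w) :=
  Submodule.finrank_lt_finrank_of_lt (by
    refine lt_of_le_of_ne le_sup_left fun h => hw ?_
    rw [h]
    exact Submodule.mem_sup_right (Submodule.mem_span_singleton_self w))

/-- A simultaneous version of Rado's theorem on independent transversals, for subspaces of a vector
space over an infinite field: a single choice of vectors `w j ∈ U j` is independent modulo each of
finitely many subspaces `Z a` for which the rank condition holds. -/
theorem exists_transversal [Infinite K] [FiniteDimensional K W]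
    [DecidableEq ι] [Finite κ]
    (U : ι → Submodule K W) (s : Finset ι) :
    ∀ (Z : κ → Submodule K W) (n : κ → ℕ) (T : κ → Finset ι), (∀ a, T a ⊆ s) →
      (∀ a, ∀ J ⊆ T a, n a + J.card ≤ finrank K ↥(Z a ⊔ J.sup U)) →
      ∃ w : ι → W, (∀ j, w j ∈ U j) ∧
        ∀ a, n a + (T a).card ≤ finrank K ↥(Z a ⊔ Submodule.span K (w '' T a)) := by
  induction s using Finset.induction_on with
  | empty =>
    intro Z n T hT h
    refine ⟨0, fun j => zero_mem _, fun a => ?_⟩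
    have := h a ∅ (Finset.empty_subset _)
    rw [Finset.subset_empty.1 (hT a), Finset.coe_empty, Set.image_empty, Submodule.span_empty]
    rwa [Finset.sup_empty] at this
  | insert i s his ih =>
    intro Z n T hT h
    -- A vector `v ∈ U i` outside all these subspaces enlarges every `Z a ⊔ J.sup U` that `U i`
    -- enlarges, simultaneously for all `a` and `J`.
    let 𝓟 : Set (Submodule K W) :=
      {P | ¬ U i ≤ P} ∩ ⋃ a, (fun J : Finset ι => Z a ⊔ J.sup U) '' ((T a).powerset : Set (Finset ι))
    have hfin : 𝓟.Finite :=
      (Set.finite_iUnion fun a => ((T a).powerset.finite_toSet.image _)).inter_of_right _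
    obtain ⟨v, hv, hvP⟩ := exists_mem_forall_notMem (U i) hfin fun P hP => hP.1
    -- The choice `w i = v` is absorbed into `Z a`, and the target rank grows by one, for exactly
    -- those `a` with `i ∈ T a`.
    obtain ⟨w, hw, hwT⟩ := ih (fun a => if i ∈ T a then Z a ⊔ K ∙ v else Z a)
      (fun a => if i ∈ T a then n a + 1 else n a) (fun a => (T a).erase i)
      (fun a => Finset.subset_insert_iff.1 (hT a)) (by
        intro a J hJ
        have hiJ : i ∉ J := fun hi => by simpa using hJ hi
        have hJT : J ⊆ T a := hJ.trans (Finset.erase_subset _ _)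
        by_cases hi : i ∈ T a
        · rw [if_pos hi, if_pos hi]
          -- If `U i` adds nothing, the hypothesis for `insert i J` already supplies the extra
          -- dimension; otherwise `v` supplies it.
          by_cases hU : U i ≤ Z a ⊔ J.sup U
          · have h1 := h a (insert i J) (Finset.insert_subset hi hJT)
            rw [Finset.card_insert_of_notMem hiJ, Finset.sup_insert] at h1
            have h2 : Z a ⊔ (U i ⊔ J.sup U) ≤ Z a ⊔ K ∙ v ⊔ J.sup U :=
              sup_le (le_sup_left.trans le_sup_left) (sup_le (hU.trans
                (sup_le_sup_right le_sup_left _)) le_sup_right)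
            have := Submodule.finrank_mono h2
            omega
          · have hv' := hvP _ ⟨hU, Set.mem_iUnion.2 ⟨a, J, by simpa using hJT, rfl⟩⟩
            have h1 := h a J hJT
            have h2 := finrank_lt_sup_span_singleton hv'
            rw [sup_right_comm] at h2
            omega
        · rw [if_neg hi, if_neg hi]
          exact h a J hJT)
    refine ⟨Function.update w i v, fun j => ?_, fun a => ?_⟩
    · by_cases hj : j = i
      · subst hj; simpa using hv
      · simpa [hj] using hw j
    · have h1 := hwT a
      have himg : w '' ((T a).erase i : Finset ι) =
          Function.update w i v '' ((T a).erase i : Finset ι) := by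
        refine Set.image_congr fun j hj => ?_
        rw [Function.update_of_ne (Finset.ne_of_mem_erase (Finset.mem_coe.1 hj))]
      rw [himg] at h1
      by_cases hi : i ∈ T a
      · rw [if_pos hi, if_pos hi] at h1
        have h2 := Finset.card_erase_add_one hi
        have h3 : Z a ⊔ K ∙ v ⊔ Submodule.span K (Function.update w i v '' ((T a).erase i : Finset ι))
            = Z a ⊔ Submodule.span K (Function.update w i v '' T a) := by
          conv_rhs => rw [← Finset.insert_erase hi, Finset.coe_insert, Set.image_insert_eq,
            Function.update_self, Submodule.span_insert]
          rw [sup_assoc]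
        rw [h3] at h1
        omega
      · rwa [if_neg hi, if_neg hi, Finset.erase_eq_of_notMem hi] at h1

/-- If the subspaces `U i` have dimension at most `m` modulo `X`, then there are `m` functionals
that vanish on `X`, do not vanish at a given `e ∉ X`, and have no common zeros on `U i` outside
`X`. -/
theorem exists_functionals [Infinite K] [FiniteDimensional K W] [Finite ι] (X : Submodule K W)
    {e : W} (he : e ∉ X) (m : ℕ) : ∀ U : ι → Submodule K W,
      (∀ i, finrank K (U i) ≤ finrank K ↥(U i ⊓ X) + m) →
      ∃ f : Fin m → Dual K W, (∀ k, X ≤ LinearMap.ker (f k)) ∧ (∀ k, f k e ≠ 0) ∧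
        ∀ i, U i ⊓ ⨅ k, LinearMap.ker (f k) ≤ X := by
  induction m with
  | zero =>
    intro U hU
    refine ⟨fun k => k.elim0, fun k => k.elim0, fun k => k.elim0, fun i => ?_⟩
    have := Submodule.eq_of_le_of_finrank_le (inf_le_left : U i ⊓ X ≤ U i) (by simpa using hU i)
    exact inf_le_left.trans (inf_eq_left.1 this)
  | succ m ih =>
    intro U hU
    -- The functionals to avoid: those vanishing at `e`, or on all of some `U i` not contained in
    -- `X`.
    let s : Set (Submodule K (Dual K W)) := insert (LinearMap.ker (Dual.eval K W e))
      ((fun i => (U i).dualAnnihilator) '' {i | ¬ U i ≤ X})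
    have hs : s.Finite := (Set.toFinite _).insert _
    obtain ⟨g, hgX, hg⟩ := exists_mem_forall_notMem X.dualAnnihilator hs (by
      have key : ∀ u ∉ X, ∃ g ∈ X.dualAnnihilator, g u ≠ 0 := by
        intro u hu
        obtain ⟨g, hgu, hgX⟩ := Submodule.exists_dual_map_eq_bot_of_notMem hu inferInstance
        exact ⟨g, (Submodule.mem_dualAnnihilator g).2 fun x hx => by
          have := Submodule.mem_map_of_mem (f := g) hx
          rwa [hgX, Submodule.mem_bot] at this, hgu⟩
      rintro P (rfl | ⟨i, hi, rfl⟩) hle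
      · obtain ⟨g, hg, hge⟩ := key e he
        exact hge (hle hg)
      · obtain ⟨u, hu, huX⟩ := SetLike.not_le_iff_exists.1 hi
        obtain ⟨g, hg, hge⟩ := key u huX
        exact hge ((Submodule.mem_dualAnnihilator g).1 (hle hg) u hu))
    rw [Submodule.mem_dualAnnihilator] at hgX
    -- Since `X ≤ ker g`, passing to `U i ⊓ ker g` keeps the intersection with `X` and lowers the
    -- dimension of each `U i` not inside `X`.
    obtain ⟨f, hfX, hfe, hf⟩ := ih (fun i => U i ⊓ LinearMap.ker g) (by
      intro i
      have h1 : U i ⊓ LinearMap.ker g ⊓ X = U i ⊓ X := by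
        rw [inf_assoc, inf_eq_right.2 (show X ≤ LinearMap.ker g from fun x hx => hgX x hx)]
      rw [h1]
      by_cases hi : U i ≤ X
      · rw [inf_eq_left.2 hi]
        exact (Submodule.finrank_mono inf_le_left).trans (Nat.le_add_right _ _)
      · have h2 : U i ⊓ LinearMap.ker g < U i := by
          refine inf_lt_left.2 fun hle => hg _ (Or.inr ⟨i, hi, rfl⟩) ?_
          exact (Submodule.mem_dualAnnihilator g).2 fun u hu => hle hu
        have := Submodule.finrank_lt_finrank_of_lt h2
        have := hU i
        omega)
    refine ⟨Fin.cons g f, Fin.cases (fun x hx => hgX x hx) hfX,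
      Fin.cases (hg _ (Or.inl rfl)) hfe, fun i x hx => hf i ?_⟩
    simp only [Submodule.mem_inf, Submodule.mem_iInf, LinearMap.mem_ker] at hx ⊢
    exact ⟨⟨hx.1, by simpa using hx.2 0⟩, fun k => by simpa using hx.2 k.succ⟩

end Transversal

/-! ### Generic tuples of points and polynomial conditions -/

section Generic

variable {V : Type*} [AddCommGroup V] [Module ℝ V]

/-- The functional on `V* × ℝ` given by evaluation at `(q, 1)`. -/
def evalPoint (q : V) : Dual ℝ (Dual ℝ V × ℝ) :=
  (Dual.eval ℝ V q).coprod LinearMap.id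

@[simp] theorem evalPoint_apply (q : V) (φ : Dual ℝ V × ℝ) : evalPoint q φ = φ.1 q + φ.2 := rfl

variable [FiniteDimensional ℝ V] {m : ℕ}

theorem ForGenericPoints.mono {Q R : (Fin m → V) → Prop} (hQ : ForGenericPoints m Q)
    (h : ∀ p, Q p → R p) : ForGenericPoints m R := by
  obtain ⟨P, hP, hPQ⟩ := hQ
  exact ⟨P, hP, fun p hp => h p (hPQ p hp)⟩

theorem ForGenericPoints.and {Q R : (Fin m → V) → Prop} (hQ : ForGenericPoints m Q)
    (hR : ForGenericPoints m R) : ForGenericPoints m fun p => Q p ∧ R p := by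
  obtain ⟨P, hP, hPQ⟩ := hQ
  obtain ⟨P', hP', hPR⟩ := hR
  refine ⟨P * P', mul_ne_zero hP hP', fun p hp => ?_⟩
  rw [map_mul] at hp
  exact ⟨hPQ p (left_ne_zero_of_mul hp), hPR p (right_ne_zero_of_mul hp)⟩

theorem ForGenericPoints.forall_mem {ι : Type*} (s : Finset ι) {Q : ι → (Fin m → V) → Prop}
    (h : ∀ i ∈ s, ForGenericPoints m (Q i)) : ForGenericPoints m fun p => ∀ i ∈ s, Q i p := by
  classical
  induction s using Finset.induction_on with
  | empty => exact ⟨1, one_ne_zero, by simp⟩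
  | insert i s _ ih =>
    refine ((h i (Finset.mem_insert_self i s)).and
      (ih fun j hj => h j (Finset.mem_insert_of_mem hj))).mono fun p hp => ?_
    simpa using hp

/-- The subalgebra of polynomial functions of `m` points of `V`. -/
def polynomialFunctions (V : Type*) [AddCommGroup V] [Module ℝ V] [FiniteDimensional ℝ V] (m : ℕ) :
    Subalgebra ℝ ((Fin m → V) → ℝ) :=
  (AlgHom.pi fun p : Fin m → V =>
    MvPolynomial.aeval fun ij : Fin m × Fin (finrank ℝ V) => (finBasis ℝ V).repr (p ij.1) ij.2).range

theorem mem_polynomialFunctions {g : (Fin m → V) → ℝ} : g ∈ polynomialFunctions V m ↔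
    ∃ P : MvPolynomial (Fin m × Fin (finrank ℝ V)) ℝ, ∀ p : Fin m → V,
      MvPolynomial.eval (fun ij => (finBasis ℝ V).repr (p ij.1) ij.2) P = g p := by
  simp only [polynomialFunctions, AlgHom.mem_range, funext_iff, AlgHom.pi_apply,
    MvPolynomial.aeval_eq_eval]

theorem apply_mem_polynomialFunctions (β : Dual ℝ V) (i : Fin m) :
    (fun p : Fin m → V => β (p i)) ∈ polynomialFunctions V m := by
  refine mem_polynomialFunctions.2
    ⟨∑ j, MvPolynomial.C (β (finBasis ℝ V j)) * MvPolynomial.X (i, j), fun p => ?_⟩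
  conv_rhs => rw [← (finBasis ℝ V).sum_repr (p i)]
  simp only [map_sum, map_smul, smul_eq_mul, map_mul, MvPolynomial.eval_C, MvPolynomial.eval_X,
    mul_comm]

theorem ForGenericPoints.of_polynomialFunction {g : (Fin m → V) → ℝ}
    (hg : g ∈ polynomialFunctions V m) (p₀ : Fin m → V) (h₀ : g p₀ ≠ 0) :
    ForGenericPoints m fun p => g p ≠ 0 := by
  obtain ⟨P, hP⟩ := mem_polynomialFunctions.1 hg
  refine ⟨P, fun h => h₀ (by rw [← hP, h, map_zero]), fun p hp => by
    beta_reduce; rwa [← hP]⟩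

/-- Let `u` be a linear map to a space `G` and let `B k` be linear maps to `V* × ℝ`. If
for one tuple of points `u` and the evaluations of `B k` at these points have no common zeros, then
this is so for generic tuples of points. -/
theorem ForGenericPoints.of_exists {E G κ : Type*} [AddCommGroup E] [Module ℝ E]
    [FiniteDimensional ℝ E] [AddCommGroup G] [Module ℝ G] [Finite κ]
    (u : E →ₗ[ℝ] G) (B : κ → E →ₗ[ℝ] Dual ℝ V × ℝ)
    (h : ∃ p : Fin m → V, ∀ x, u x = 0 → (∀ k i, evalPoint (p i) (B k x) = 0) → x = 0) :
    ForGenericPoints m fun p : Fin m → V =>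
      ∀ x, u x = 0 → (∀ k i, evalPoint (p i) (B k x) = 0) → x = 0 := by
  classical
  have := Fintype.ofFinite κ
  obtain ⟨p₀, h₀⟩ := h
  let F : (Fin m → V) → E →ₗ[ℝ] G × (κ × Fin m → ℝ) := fun p =>
    u.prod (LinearMap.pi fun ki => evalPoint (p ki.2) ∘ₗ B ki.1)
  have hF : ∀ p x, F p x = 0 ↔ u x = 0 ∧ ∀ k i, evalPoint (p i) (B k x) = 0 := by
    intro p x
    simp [F, Prod.ext_iff, funext_iff]
  -- With the left inverse `N` of `F p₀` held fixed, `det (N ∘ F p)` is polynomial in `p`, equals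
  -- `1` at `p₀`, and its nonvanishing forces `F p` to be injective.
  obtain ⟨N, hN⟩ := LinearMap.exists_leftInverse_of_injective (F p₀)
    (LinearMap.ker_eq_bot'.2 fun x hx => h₀ x ((hF p₀ x).1 hx).1 ((hF p₀ x).1 hx).2)
  let b := finBasis ℝ E
  have hpoly : ∀ (f : Dual ℝ (G × (κ × Fin m → ℝ))) (x : E),
      (fun p => f (F p x)) ∈ polynomialFunctions V m := by
    intro f x
    have : (fun p => f (F p x)) = algebraMap ℝ ((Fin m → V) → ℝ) (f (u x, 0)) +
        ∑ ki : κ × Fin m, algebraMap ℝ ((Fin m → V) → ℝ) (f (0, Pi.single ki 1)) *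
          ((fun p => (B ki.1 x).1 (p ki.2)) + algebraMap ℝ ((Fin m → V) → ℝ) (B ki.1 x).2) := by
      funext p
      have h1 : F p x = (u x, 0) + ∑ ki : κ × Fin m, evalPoint (p ki.2) (B ki.1 x) •
          ((0, Pi.single ki 1) : G × (κ × Fin m → ℝ)) := by
        refine Prod.ext ?_ ?_
        · simp [F, Prod.fst_sum]
        · funext ki
          simp [F, Prod.snd_sum, Pi.single_apply]
      rw [h1, map_add, map_sum]
      simp only [map_smul, smul_eq_mul, evalPoint_apply, Pi.add_apply, Finset.sum_apply,
        Pi.mul_apply, Pi.algebraMap_apply, Algebra.algebraMap_self, RingHom.id_apply, mul_comm]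
    rw [this]
    refine add_mem (Subalgebra.algebraMap_mem _ _) (sum_mem fun ki _ =>
      mul_mem (Subalgebra.algebraMap_mem _ _) (add_mem ?_ (Subalgebra.algebraMap_mem _ _)))
    exact apply_mem_polynomialFunctions _ _
  have hdet : (fun p => LinearMap.det (N ∘ₗ F p)) ∈ polynomialFunctions V m := by
    have : (fun p => LinearMap.det (N ∘ₗ F p)) = ∑ σ : Equiv.Perm (Fin (finrank ℝ E)),
        algebraMap ℝ ((Fin m → V) → ℝ) (Equiv.Perm.sign σ : ℤ) *
          ∏ i, fun p => (b.coord (σ i) ∘ₗ N) (F p (b i)) := by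
      funext p
      rw [← LinearMap.det_toMatrix b, Matrix.det_apply']
      simp [LinearMap.toMatrix_apply]
    rw [this]
    exact sum_mem fun σ _ => mul_mem (Subalgebra.algebraMap_mem _ _)
      (prod_mem fun i _ => hpoly _ _)
  refine (ForGenericPoints.of_polynomialFunction hdet p₀ (by simp [hN])).mono
    fun p hp x hx hx' => ?_
  have hx0 : (N ∘ₗ F p) x = 0 := by
    rw [LinearMap.comp_apply, (hF p x).2 ⟨hx, hx'⟩, map_zero]
  exact LinearMap.ker_eq_bot'.1
    (LinearEquiv.ofIsUnitDet (v := b) (v' := b) (f := N ∘ₗ F p) (by simpa using hp)).ker x hx0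

end Generic

end ValidOrder

end

noncomputable section

namespace ValidOrder

open Module

/-! ### Rank, closure and flats of linear matroids -/

section LinearMatroid

variable {K W ι : Type*} [Field K] [AddCommGroup W] [Module K W] {v : ι → W} {E F I X : Set ι}

@[simp] theorem linearMatroid_ground : (linearMatroid (K := K) v E).E = E := rfl

theorem linearMatroid_indep :
    (linearMatroid (K := K) v E).Indep I ↔ I ⊆ E ∧ LinearIndepOn K v I := by
  simp [linearMatroid]

theorem span_eq_of_isBasis (h : (linearMatroid (K := K) v E).IsBasis I X) :
    Submodule.span K (v '' I) = Submodule.span K (v '' X) := by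
  refine le_antisymm (Submodule.span_mono (Set.image_mono h.subset)) (Submodule.span_le.2 ?_)
  rintro _ ⟨e, he, rfl⟩
  by_contra hv
  have hI := linearMatroid_indep.1 h.indep
  have heI := h.mem_of_insert_indep he (linearMatroid_indep.2
    ⟨Set.insert_subset (h.subset_ground he) hI.1, hI.2.insert hv⟩)
  exact hv (Submodule.subset_span ⟨e, heI, rfl⟩)

theorem finrank_span_of_linearIndepOn (hI : I.Finite) (h : LinearIndepOn K v I) :
    finrank K (Submodule.span K (v '' I)) = I.ncard := by
  have := hI.fintype
  rw [Set.ncard_eq_toFinset_card', Set.toFinset_card, ← finrank_span_eq_card h,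
    Set.image_eq_range]

theorem eRk_linearMatroid (hX : X.Finite) (hXE : X ⊆ E) :
    (linearMatroid (K := K) v E).eRk X = finrank K (Submodule.span K (v '' X)) := by
  obtain ⟨I, hI⟩ := (linearMatroid (K := K) v E).exists_isBasis X hXE
  have hfin := hX.subset hI.subset
  rw [← hI.encard_eq_eRk, ← span_eq_of_isBasis hI,
    finrank_span_of_linearIndepOn hfin (linearMatroid_indep.1 hI.indep).2, hfin.cast_ncard_eq]

theorem mem_closure_linearMatroid (hF : F ⊆ E) {e : ι} :
    e ∈ (linearMatroid (K := K) v E).closure F ↔ e ∈ E ∧ v e ∈ Submodule.span K (v '' F) := by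
  obtain ⟨I, hI⟩ := (linearMatroid (K := K) v E).exists_isBasis F hF
  have h := linearMatroid_indep.1 hI.indep
  rw [← hI.closure_eq_closure, hI.indep.mem_closure_iff', linearMatroid_ground,
    linearMatroid_indep, linearIndepOn_insert_iff, Set.insert_subset_iff, ← span_eq_of_isBasis hI]
  have : e ∈ I → v e ∈ Submodule.span K (v '' I) := fun he => Submodule.subset_span ⟨e, he, rfl⟩
  have := h.1
  have := h.2
  tauto

theorem isFlat_linearMatroid : (linearMatroid (K := K) v E).IsFlat F ↔
    F ⊆ E ∧ ∀ e ∈ E, v e ∈ Submodule.span K (v '' F) → e ∈ F := by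
  constructor
  · intro h
    have hF : F ⊆ E := h.subset_ground
    refine ⟨hF, fun e he hv => ?_⟩
    rw [← h.closure]
    exact (mem_closure_linearMatroid hF).2 ⟨he, hv⟩
  · rintro ⟨hF, h⟩
    refine Matroid.isFlat_iff_closure_eq.2 (Set.Subset.antisymm (fun e he => ?_)
      (Matroid.subset_closure _ F hF))
    have := (mem_closure_linearMatroid hF).1 he
    exact h e this.1 this.2

end LinearMatroid

/-! ### Affine functions vanishing at given or generic points -/

section Points

variable {V : Type*} [AddCommGroup V] [Module ℝ V] {m : ℕ}

/-- The functionals in `V* × ℝ` that vanish at the points `(p k, 1)`. -/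
def vanishing (p : Fin m → V) : Submodule ℝ (Dual ℝ V × ℝ) :=
  ⨅ k, LinearMap.ker (evalPoint (p k))

theorem mem_vanishing {p : Fin m → V} {φ : Dual ℝ V × ℝ} :
    φ ∈ vanishing p ↔ ∀ k, φ.1 (p k) + φ.2 = 0 := by
  simp [vanishing]

variable [FiniteDimensional ℝ V]

/-- Vanishing at `m` points imposes at most `m` linear conditions. No genericity is needed in this
direction. -/
theorem finrank_le_finrank_inf_vanishing_add (U : Submodule ℝ (Dual ℝ V × ℝ)) (p : Fin m → V) :
    finrank ℝ U ≤ finrank ℝ ↥(U ⊓ vanishing p) + m := by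
  let L : U →ₗ[ℝ] Fin m → ℝ := LinearMap.pi fun k => evalPoint (p k) ∘ₗ U.subtype
  have h1 := LinearMap.finrank_range_add_finrank_ker (K := ℝ) (V := U) (V₂ := Fin m → ℝ) L
  have h2 := Submodule.finrank_le (LinearMap.range L)
  rw [finrank_fin_fun] at h2
  have h3 : (LinearMap.ker L).map U.subtype ≤ U ⊓ vanishing p := by
    rintro _ ⟨x, hx, rfl⟩
    refine ⟨x.2, mem_vanishing.2 fun k => ?_⟩
    exact congrFun (LinearMap.mem_ker.1 hx) k
  have h4 := Submodule.finrank_mono h3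
  rw [Submodule.finrank_map_subtype_eq] at h4
  omega

/-- Rescaling `f` to take the value `1` at `(0, 1)`, its restriction to `V*` is evaluation at a
point by reflexivity. The condition at `(0, 1)` rules out points at infinity. -/
theorem exists_evalPoint_eq_zero_iff (f : Dual ℝ (Dual ℝ V × ℝ)) (hf : f (0, 1) ≠ 0) :
    ∃ q : V, ∀ φ, evalPoint q φ = 0 ↔ f φ = 0 := by
  refine ⟨(evalEquiv ℝ V).symm ((f (0, 1))⁻¹ • f ∘ₗ LinearMap.inl ℝ (Dual ℝ V) ℝ), fun φ => ?_⟩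
  have h1 : f φ = f (φ.1, 0) + φ.2 * f (0, 1) := by
    rw [← smul_eq_mul, ← map_smul, ← map_add]
    simp
  rw [evalPoint_apply, apply_evalEquiv_symm_apply, h1]
  simp only [LinearMap.smul_apply, LinearMap.comp_apply, LinearMap.inl_apply, smul_eq_mul]
  field_simp
  rw [mul_zero]

theorem exists_points {κ : Type*} [Finite κ] (X : Submodule ℝ (Dual ℝ V × ℝ))
    (hX : ((0, 1) : Dual ℝ V × ℝ) ∉ X)
    (m : ℕ) (U : κ → Submodule ℝ (Dual ℝ V × ℝ))
    (hU : ∀ i, finrank ℝ (U i) ≤ finrank ℝ ↥(U i ⊓ X) + m) :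
    ∃ p : Fin m → V, ∀ i, U i ⊓ vanishing p ≤ X := by
  obtain ⟨f, -, hfe, hf⟩ := exists_functionals X hX m U hU
  choose p hp using fun k => exists_evalPoint_eq_zero_iff (f k) (hfe k)
  refine ⟨p, fun i x hx => hf i ⟨hx.1, ?_⟩⟩
  simp only [vanishing, Submodule.mem_inf, Submodule.mem_iInf, LinearMap.mem_ker, hp,
    SetLike.mem_coe] at hx ⊢
  exact hx.2

/-- A subspace of dimension at most `m` contains no nonzero functional vanishing at `m` generic
points. -/
theorem forGenericPoints_inf_vanishing_eq_bot (U : Submodule ℝ (Dual ℝ V × ℝ))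
    (hU : finrank ℝ U ≤ m) : ForGenericPoints m fun p : Fin m → V => U ⊓ vanishing p = ⊥ := by
  refine (ForGenericPoints.of_exists (E := U) (0 : U →ₗ[ℝ] ℝ) (fun _ : Unit => U.subtype) ?_).mono
    fun p hp => ?_
  · obtain ⟨p, hp⟩ := exists_points (V := V) ⊥ (by simp) m (fun _ : Unit => U)
      (fun _ => hU.trans (Nat.le_add_left _ _))
    refine ⟨p, fun x _ hx => ?_⟩
    have := hp () ⟨x.2, mem_vanishing.2 (hx ())⟩
    simpa using this
  · rw [eq_bot_iff]
    rintro x ⟨hxU, hx⟩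
    have := hp ⟨x, hxU⟩ rfl fun _ => mem_vanishing.1 hx
    simpa using this

/-- The core of the proof: the points are chosen so that each `U i ⊓ vanishing p` lies on the line
of a preselected vector `w i`, where the `w i` are independent. -/
theorem exists_points_independent {ι : Type*} [Fintype ι] (hm : 1 ≤ m)
    (U : ι → Submodule ℝ (Dual ℝ V × ℝ)) (hU : ∀ i, finrank ℝ (U i) = m + 1)
    (h : ∀ J : Finset ι, J.Nonempty → J.card + m ≤ finrank ℝ ↥(J.sup U)) :
    ∃ p : Fin m → V, ∀ x : ∀ i, U i, ∑ i, (x i : Dual ℝ V × ℝ) = 0 →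
      (∀ i, (x i : Dual ℝ V × ℝ) ∈ vanishing p) → x = 0 := by
  classical
  let e : Dual ℝ V × ℝ := (0, 1)
  have he : e ≠ 0 := by simp [e]
  -- The index `none` makes all `w i` independent together with `e`; the index `some i` makes the `w
  -- j`, `j ≠ i`, independent modulo `U i`.
  obtain ⟨w, hwU, hw⟩ := exists_transversal (κ := Option ι) U Finset.univ
    (fun a => a.elim (ℝ ∙ e) U) (fun a => a.elim 1 fun _ => m + 1)
    (fun a => a.elim Finset.univ fun i => Finset.univ.erase i) (fun _ => Finset.subset_univ _) (by
      rintro (_ | i) J hJ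
      · change 1 + J.card ≤ finrank ℝ ↥(ℝ ∙ e ⊔ J.sup U)
        rcases J.eq_empty_or_nonempty with rfl | hne
        · rw [Finset.sup_empty, sup_bot_eq, finrank_span_singleton he, Finset.card_empty]
        · have := h J hne
          have := Submodule.finrank_mono (le_sup_right : J.sup U ≤ ℝ ∙ e ⊔ J.sup U)
          omega
      · change m + 1 + J.card ≤ finrank ℝ ↥(U i ⊔ J.sup U)
        have hiJ : i ∉ J := fun hi => by simpa using hJ hi
        have := h (insert i J) (Finset.insert_nonempty _ _)
        rw [Finset.card_insert_of_notMem hiJ, Finset.sup_insert] at this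
        omega)
  set X := Submodule.span ℝ (Set.range w) with hXdef
  have hcard : finrank ℝ X ≤ Fintype.card ι := finrank_range_le_card w
  have h0 : 1 + Fintype.card ι ≤ finrank ℝ ↥(ℝ ∙ e ⊔ X) := by
    rw [hXdef, ← Set.image_univ, ← Finset.coe_univ]
    exact hw none
  have heX : e ∉ X := by
    intro heX
    rw [sup_eq_right.2 ((Submodule.span_singleton_le_iff_mem _ _).2 heX)] at h0
    omega
  have hli : LinearIndependent ℝ w := by
    rw [linearIndependent_iff_card_le_finrank_span]
    have h1 := Submodule.finrank_add_le_finrank_add_finrank (ℝ ∙ e) X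
    rw [finrank_span_singleton he] at h1
    change _ ≤ finrank ℝ X
    omega
  have hwX : ∀ i, w i ∈ U i ⊓ X := fun i => ⟨hwU i, Submodule.subset_span ⟨i, rfl⟩⟩
  have hle : ∀ i, ℝ ∙ w i ≤ U i ⊓ X := fun i =>
    (Submodule.span_singleton_le_iff_mem _ _).2 (hwX i)
  -- With `n` indices, `U i ⊔ X` has dimension at least `m + n`, while `U i` has dimension `m + 1`
  -- and `X` at most `n`; so the intersection is at most a line.
  have hUX : ∀ i, U i ⊓ X = ℝ ∙ w i := by
    intro i
    refine (Submodule.eq_of_le_of_finrank_le (hle i) ?_).symm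
    rw [finrank_span_singleton (hli.ne_zero i)]
    have h1 : m + 1 + (Finset.univ.erase i).card ≤ finrank ℝ
        ↥(U i ⊔ Submodule.span ℝ (w '' ((Finset.univ.erase i : Finset ι) : Set ι))) := hw (some i)
    rw [Finset.card_erase_of_mem (Finset.mem_univ i), Finset.card_univ] at h1
    have h2 := Submodule.finrank_mono (sup_le_sup_left (Submodule.span_mono
      (Set.image_subset_range w ((Finset.univ.erase i : Finset ι) : Set ι))) (U i))
    have h3 := Submodule.finrank_sup_add_finrank_inf_eq (U i) X
    have h4 := hU i
    have h5 := Fintype.card_pos_iff.2 ⟨i⟩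
    rw [← hXdef] at h2
    omega
  obtain ⟨p, hp⟩ := exists_points X heX m U (fun i => by
    rw [hUX, finrank_span_singleton (hli.ne_zero i), hU, add_comm])
  refine ⟨p, fun x hx0 hx => ?_⟩
  have hxw : ∀ i, ∃ c : ℝ, c • w i = x i := by
    intro i
    have : (x i : Dual ℝ V × ℝ) ∈ U i ⊓ X := ⟨(x i).2, hp i ⟨(x i).2, hx i⟩⟩
    rwa [hUX, Submodule.mem_span_singleton] at this
  choose c hc using hxw
  have hc0 := Fintype.linearIndependent_iff.1 hli c (by simpa only [hc] using hx0)
  funext i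
  exact Subtype.ext (by rw [← hc i, hc0 i, zero_smul]; rfl)

/-- Let `U i` be subspaces of dimension `m + 1`, any `j ≥ 1` of which span a subspace of dimension
at least `j + m`. Then for `m` generic points, the spaces of those functionals in the `U i` that
vanish at these points are independent. -/
theorem forGenericPoints_independent {ι : Type*} [Fintype ι] (hm : 1 ≤ m)
    (U : ι → Submodule ℝ (Dual ℝ V × ℝ)) (hU : ∀ i, finrank ℝ (U i) = m + 1)
    (h : ∀ J : Finset ι, J.Nonempty → J.card + m ≤ finrank ℝ ↥(J.sup U)) :
    ForGenericPoints m fun p : Fin m → V => ∀ x : ∀ i, U i, ∑ i, (x i : Dual ℝ V × ℝ) = 0 →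
      (∀ i, (x i : Dual ℝ V × ℝ) ∈ vanishing p) → x = 0 := by
  have key := ForGenericPoints.of_exists (V := V) (m := m) (E := ∀ i, U i)
    (∑ i, (U i).subtype ∘ₗ LinearMap.proj i : (∀ i, U i) →ₗ[ℝ] Dual ℝ V × ℝ)
    (fun i => (U i).subtype ∘ₗ LinearMap.proj i) (by
      obtain ⟨p, hp⟩ := exists_points_independent hm U hU h
      exact ⟨p, fun x hx hx' => hp x (by simpa [LinearMap.sum_apply] using hx)
        fun i => mem_vanishing.2 (hx' i)⟩)
  exact key.mono fun p hp x hx hx' => hp x (by simpa [LinearMap.sum_apply] using hx)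
    fun i => mem_vanishing.1 (hx' i)

end Points

end ValidOrder

end

noncomputable section

namespace ValidOrder

open Module

/-! ### A linear representation of the Dilworth truncation -/

section DilworthTruncation

theorem dilworthTruncation_indep {α : Type*} {k : ℕ} {M : Matroid α} {I : Set (Finset α)} :
    (dilworthTruncation k M).Indep I ↔
      I ⊆ {s : Finset α | (s : Set α) ⊆ M.E ∧ s.card = k + 1} ∧ DilworthCondition M k I := by
  simp [dilworthTruncation]

variable {V ι : Type*} [AddCommGroup V] [Module ℝ V] {m : ℕ}
  {v : ι → Dual ℝ V × ℝ} {A : Finset ι}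

/-- The span of the vectors `v i`, `i ∈ S`. -/
def spanOn (v : ι → Dual ℝ V × ℝ) (S : Finset ι) : Submodule ℝ (Dual ℝ V × ℝ) :=
  Submodule.span ℝ (v '' S)

theorem spanOn_mono {S T : Finset ι} (h : S ⊆ T) : spanOn v S ≤ spanOn v T :=
  Submodule.span_mono (Set.image_mono (Finset.coe_subset.2 h))

theorem span_image_biUnion (I : Finset (Finset ι)) :
    Submodule.span ℝ (v '' ⋃ s ∈ I, (s : Set ι)) = I.sup (spanOn v) := by
  simp only [Set.image_iUnion, Submodule.span_iUnion, Finset.sup_eq_iSup, spanOn]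

theorem le_eRk_iff {I : Finset (Finset ι)} (hI : ∀ s ∈ I, s ⊆ A) (n : ℕ) :
    (n : ℕ∞) ≤ (linearMatroid (K := ℝ) v (A : Set ι)).eRk (⋃ s ∈ I, (s : Set ι)) ↔
      n ≤ finrank ℝ ↥(I.sup (spanOn v)) := by
  have hfin : (⋃ s ∈ I, (s : Set ι)).Finite := I.finite_toSet.biUnion fun s _ => s.finite_toSet
  rw [eRk_linearMatroid hfin (Set.iUnion₂_subset fun s hs => Finset.coe_subset.2 (hI s hs)),
    span_image_biUnion, Nat.cast_le]

theorem finrank_spanOn_le_card (S : Finset ι) : finrank ℝ (spanOn v S) ≤ S.card := by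
  classical
  rw [spanOn, ← Finset.coe_image]
  exact (finrank_span_finset_le_card _).trans Finset.card_image_le

theorem exists_subset_finrank_spanOn_eq {T : Finset ι} (h : m ≤ finrank ℝ (spanOn v T)) :
    ∃ S ⊆ T, finrank ℝ (spanOn v S) = m := by
  classical
  obtain ⟨I, hI⟩ := (linearMatroid (K := ℝ) v (T : Set ι)).exists_isBasis T subset_rfl
  have hli := (linearMatroid_indep.1 hI.indep).2
  lift I to Finset ι using T.finite_toSet.subset hI.subset
  rw [spanOn, ← span_eq_of_isBasis hI, finrank_span_of_linearIndepOn I.finite_toSet hli,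
    Set.ncard_coe_finset] at h
  obtain ⟨S, hS, hcard⟩ := Finset.exists_subset_card_eq h
  refine ⟨S, hS.trans (Finset.coe_subset.1 hI.subset), ?_⟩
  rw [spanOn, finrank_span_of_linearIndepOn S.finite_toSet (hli.mono (Finset.coe_subset.2 hS)),
    Set.ncard_coe_finset, hcard]

theorem finrank_spanOn_of_dilworthCondition {I : Set (Finset ι)}
    (hI : DilworthCondition (linearMatroid (K := ℝ) v (A : Set ι)) m I) {S : Finset ι}
    (hS : S ∈ I) (hSA : S ∈ A.powersetCard (m + 1)) : finrank ℝ (spanOn v S) = m + 1 := by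
  rw [Finset.mem_powersetCard] at hSA
  refine le_antisymm ((finrank_spanOn_le_card S).trans hSA.2.le) ?_
  have := (le_eRk_iff (by simpa using hSA.1) _).1 (hI {S} (by simpa using hS)
    (Finset.singleton_nonempty S))
  rw [Finset.sup_singleton, Finset.card_singleton] at this
  omega

variable [FiniteDimensional ℝ V]

/-- Spans of dimension at least `m` meet the functionals vanishing at `m` points in the expected
dimension, if those of dimension `m` do. -/
theorem finrank_spanOn_inf_vanishing_add_le {p : Fin m → V}
    (hp : ∀ S ⊆ A, finrank ℝ (spanOn v S) ≤ m → spanOn v S ⊓ vanishing p = ⊥) {T : Finset ι}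
    (hT : T ⊆ A) (h : m ≤ finrank ℝ (spanOn v T)) :
    finrank ℝ ↥(spanOn v T ⊓ vanishing p) + m ≤ finrank ℝ (spanOn v T) := by
  -- An `m`-dimensional span inside `spanOn v T` is disjoint from `vanishing p`, so the dimensions
  -- of the two subspaces add up.
  obtain ⟨S, hS, hSm⟩ := exists_subset_finrank_spanOn_eq h
  have h1 := Submodule.finrank_sup_add_finrank_inf_eq (spanOn v T ⊓ vanishing p) (spanOn v S)
  have h2 : spanOn v T ⊓ vanishing p ⊓ spanOn v S = ⊥ := by
    rw [eq_bot_iff, ← hp S (hS.trans hT) hSm.le]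
    exact le_inf inf_le_right (inf_le_left.trans inf_le_right)
  rw [h2, finrank_bot, hSm] at h1
  have h3 := Submodule.finrank_mono (sup_le inf_le_left (spanOn_mono hS) :
    spanOn v T ⊓ vanishing p ⊔ spanOn v S ≤ spanOn v T)
  omega

variable (v A) in
/-- The general position condition on the points `p` with respect to the vectors `v i`, `i ∈ A`,
under which the functionals vanishing at `p` cut out the Dilworth truncation. -/
structure InGeneralPosition (p : Fin m → V) : Prop where
  inf_eq_bot : ∀ S ∈ A.powerset, finrank ℝ (spanOn v S) ≤ m → spanOn v S ⊓ vanishing p = ⊥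
  eq_zero : ∀ I ∈ (A.powersetCard (m + 1)).powerset,
    DilworthCondition (linearMatroid (K := ℝ) v (A : Set ι)) m I →
    ∀ x : Finset ι → Dual ℝ V × ℝ, (∀ S ∈ I, x S ∈ spanOn v S ⊓ vanishing p) →
      ∑ S ∈ I, x S = 0 → ∀ S ∈ I, x S = 0

-- There are finitely many conditions, so the product of their polynomials works; conditions whose
-- premise fails receive the polynomial `1`.
variable (v A) in
theorem forGenericPoints_inGeneralPosition (hm : 1 ≤ m) :
    ForGenericPoints m fun p : Fin m → V => InGeneralPosition v A p := by
  classical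
  refine ((ForGenericPoints.forall_mem (V := V) (m := m) A.powerset (Q := fun S p =>
    finrank ℝ (spanOn v S) ≤ m → spanOn v S ⊓ vanishing p = ⊥) ?_).and
    (ForGenericPoints.forall_mem (V := V) (m := m) (A.powersetCard (m + 1)).powerset
      (Q := fun I p => DilworthCondition (linearMatroid (K := ℝ) v (A : Set ι)) m I →
        ∀ x : Finset ι → Dual ℝ V × ℝ, (∀ S ∈ I, x S ∈ spanOn v S ⊓ vanishing p) →
          ∑ S ∈ I, x S = 0 → ∀ S ∈ I, x S = 0) ?_)).mono fun p hp => ⟨hp.1, hp.2⟩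
  · intro S _
    by_cases hS : finrank ℝ (spanOn v S) ≤ m
    · exact (forGenericPoints_inf_vanishing_eq_bot _ hS).mono fun p hp _ => hp
    · exact ⟨1, one_ne_zero, fun p _ h => absurd h hS⟩
  · intro I hI
    rw [Finset.mem_powerset] at hI
    by_cases hd : DilworthCondition (linearMatroid (K := ℝ) v (A : Set ι)) m I
    · refine (forGenericPoints_independent hm (fun S : I => spanOn v S.1)
        (fun S => finrank_spanOn_of_dilworthCondition hd S.2 (hI S.2)) fun J hJ => ?_).mono
        fun p hp _ x hx hx0 S hS => ?_
      · have hsub : ∀ s ∈ J.map (Function.Embedding.subtype _), s ∈ I := by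
          intro s hs
          obtain ⟨t, -, rfl⟩ := Finset.mem_map.1 hs
          exact t.2
        have := (le_eRk_iff (fun s hs => (Finset.mem_powersetCard.1 (hI (hsub s hs))).1) _).1
          (hd (J.map (Function.Embedding.subtype _)) hsub (by simpa using hJ))
        rw [Finset.sup_map, Finset.card_map] at this
        exact this
      · have := hp (fun S => ⟨x S, (hx S S.2).1⟩) (by
          simpa only [Finset.sum_coe_sort I x] using hx0) (fun S => (hx S S.2).2)
        exact congrArg Subtype.val (congrFun this ⟨S, hS⟩)
    · exact ⟨1, one_ne_zero, fun p _ h => absurd h hd⟩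

/-- The Dilworth truncation of a linear matroid is represented by the vectors in which the
`(m + 1)`-sets meet the subspace of the functionals that vanish at `m` points in general
position. -/
theorem exists_dilworthTruncation_eq_linearMatroid {p : Fin m → V} (hp : InGeneralPosition v A p) :
    ∃ y : Finset ι → Dual ℝ V × ℝ,
      (∀ S ∈ A.powersetCard (m + 1), spanOn v S ⊓ vanishing p = ℝ ∙ y S) ∧
      dilworthTruncation m (linearMatroid (K := ℝ) v (A : Set ι)) =
        linearMatroid (K := ℝ) y (A.powersetCard (m + 1) : Set (Finset ι)) := by
  classical
  have hbot : ∀ S ⊆ A, finrank ℝ (spanOn v S) ≤ m → spanOn v S ⊓ vanishing p = ⊥ :=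
    fun S hS => hp.inf_eq_bot S (Finset.mem_powerset.2 hS)
  -- The intersection has dimension at most one. It is zero when the vectors of `S` are dependent,
  -- and such an `S` becomes a loop.
  have hy : ∀ S, ∃ y, S ∈ A.powersetCard (m + 1) → spanOn v S ⊓ vanishing p = ℝ ∙ y := by
    intro S
    by_cases hS : S ∈ A.powersetCard (m + 1)
    · rw [Finset.mem_powersetCard] at hS
      have h1 : finrank ℝ ↥(spanOn v S ⊓ vanishing p) ≤ 1 := by
        rcases le_total (finrank ℝ (spanOn v S)) m with h | h
        · rw [hbot S hS.1 h, finrank_bot]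
          exact zero_le_one
        · have := finrank_spanOn_inf_vanishing_add_le hbot hS.1 h
          have := finrank_spanOn_le_card (v := v) S
          omega
      have := Module.Free.of_divisionRing ℝ ↥(spanOn v S ⊓ vanishing p)
      obtain ⟨⟨y, hy⟩⟩ := (Submodule.finrank_le_one_iff_isPrincipal _).1 h1
      exact ⟨y, fun _ => hy⟩
    · exact ⟨0, fun h => absurd h hS⟩
  choose y hy using hy
  refine ⟨y, hy, Matroid.ext_indep (by ext S; simp [dilworthTruncation]) fun I _ => ?_⟩
  rw [dilworthTruncation_indep, linearMatroid_indep]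
  have hE : {s : Finset ι | (s : Set ι) ⊆ (linearMatroid (K := ℝ) v (A : Set ι)).E ∧
      s.card = m + 1} = (A.powersetCard (m + 1) : Set (Finset ι)) := by
    ext S
    simp
  rw [hE]
  refine and_congr_right fun hIA => ⟨fun hd => ?_, fun hli I' hI' hne => ?_⟩
  · rw [linearIndepOn_iff_linearIndepOn_finset]
    intro s hs
    rw [linearIndepOn_finset_iff]
    intro f hf S hS
    have hsA : s ⊆ A.powersetCard (m + 1) := fun T hT => hIA (hs hT)
    have h0 := hp.eq_zero s (Finset.mem_powerset.2 hsA) (fun J hJ => hd J (hJ.trans hs))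
      (fun S => f S • y S) (fun T hT => by
        rw [hy T (hsA hT)]
        exact Submodule.smul_mem _ _ (Submodule.mem_span_singleton_self _)) hf S hS
    -- `y S` cannot be zero: `m` conditions on a space of dimension `m + 1` leave a nonzero
    -- solution.
    refine (smul_eq_zero.1 h0).resolve_right fun hyS => ?_
    have h1 := finrank_le_finrank_inf_vanishing_add (spanOn v S) p
    rw [finrank_spanOn_of_dilworthCondition hd (hs hS) (hsA hS), hy S (hsA hS), hyS,
      Submodule.span_zero_singleton, finrank_bot] at h1
    omega
  · have hI'A : ∀ S ∈ I', S ⊆ A := fun S hS => (Finset.mem_powersetCard.1 (hIA (hI' hS))).1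
    rw [le_eRk_iff hI'A]
    have hT : I'.sup (spanOn v) = spanOn v (I'.biUnion id) := by
      rw [← span_image_biUnion, spanOn, Finset.coe_biUnion]
      rfl
    have h1 := finrank_span_of_linearIndepOn I'.finite_toSet (hli.mono hI')
    rw [Set.ncard_coe_finset] at h1
    have h2 : Submodule.span ℝ (y '' I') ≤ spanOn v (I'.biUnion id) ⊓ vanishing p := by
      rw [Submodule.span_le]
      rintro _ ⟨S, hS, rfl⟩
      have : y S ∈ spanOn v S ⊓ vanishing p := by
        rw [hy S (hIA (hI' hS))]
        exact Submodule.mem_span_singleton_self _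
      exact ⟨spanOn_mono (Finset.subset_biUnion_of_mem id hS) this.1, this.2⟩
    have h3 := Submodule.finrank_mono h2
    have h4 := hne.card_pos
    have hTA : I'.biUnion id ⊆ A := Finset.biUnion_subset.2 hI'A
    rw [hT]
    -- A span of dimension at most `m` would contain no nonzero function vanishing at `p`, yet it
    -- contains the independent `y S` of the nonempty `I'`.
    rcases le_total (finrank ℝ (spanOn v (I'.biUnion id))) m with h | h
    · rw [hbot _ hTA h, finrank_bot] at h3
      omega
    · have := finrank_spanOn_inf_vanishing_add_le hbot hTA h
      omega

end DilworthTruncation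

/-! ### From vectors to hyperplanes and intersection lattices -/

section Arrangements

variable {V : Type*} [AddCommGroup V] [Module ℝ V]

/-- The linear form on `V × ℝ` given by an element of `V* × ℝ`. -/
def linearForm : Dual ℝ V × ℝ →ₗ[ℝ] Dual ℝ (V × ℝ) where
  toFun φ := φ.1.coprod (φ.2 • LinearMap.id)
  map_add' φ ψ := by ext <;> simp
  map_smul' c φ := by ext <;> simp

@[simp] theorem linearForm_apply (φ : Dual ℝ V × ℝ) (x : V) (t : ℝ) :
    linearForm φ (x, t) = φ.1 x + φ.2 * t := rfl

theorem linearForm_injective : Function.Injective (linearForm (V := V)) := by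
  intro φ ψ h
  refine Prod.ext (LinearMap.ext fun x => ?_) ?_
  · simpa using LinearMap.congr_fun h (x, 0)
  · simpa using LinearMap.congr_fun h (0, 1)

/-- Finite-dimensional duality, turning spans into containments of common zero sets in `V × ℝ`. It
serves both for incidence at infinity and for flats. -/
theorem mem_span_iff_linearForm [FiniteDimensional ℝ V] (s : Set (Dual ℝ V × ℝ))
    (φ : Dual ℝ V × ℝ) : φ ∈ Submodule.span ℝ s ↔
      ∀ z, (∀ ψ ∈ s, linearForm ψ z = 0) → linearForm φ z = 0 := by
  constructor
  · intro h z hz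
    have : s ⊆ LinearMap.ker (linearForm.flip z) := hz
    exact Submodule.span_le.2 this h
  · intro h
    have := FiniteDimensional.mem_span_of_iInf_ker_le_ker
      (L := fun ψ : s => linearForm ψ.1) (K := linearForm φ) (fun z hz => by
        refine h z fun ψ hψ => ?_
        simp only [Submodule.mem_iInf, LinearMap.mem_ker] at hz
        exact hz ⟨ψ, hψ⟩)
    rw [← Set.image_eq_range, ← Submodule.map_span] at this
    obtain ⟨ψ, hψ, heq⟩ := this
    rwa [← linearForm_injective heq]

theorem semicone_eq_ker (H : AffineSubspace ℝ V) :
    semicone H = LinearMap.ker (linearForm (normalVec H)) := rfl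

/-- The zero set in `V` of the affine function given by an element of `V* × ℝ`. -/
def zeroSet (φ : Dual ℝ V × ℝ) : AffineSubspace ℝ V where
  carrier := {x | φ.1 x + φ.2 = 0}
  smul_vsub_vadd_mem' c x y z hx hy hz := by
    simp only [Set.mem_ofPred_eq, vsub_eq_sub, vadd_eq_add, map_add, map_smul, map_sub,
      smul_eq_mul] at *
    linear_combination c * hx - c * hy + hz

@[simp] theorem mem_zeroSet {φ : Dual ℝ V × ℝ} {x : V} : x ∈ zeroSet φ ↔ φ.1 x + φ.2 = 0 :=
  Iff.rfl

theorem hasEquation_zeroSet {φ : Dual ℝ V × ℝ} (h : φ.1 ≠ 0) :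
    HasEquation (zeroSet φ) φ.1 (-φ.2) :=
  ⟨h, fun _ => by rw [mem_zeroSet, add_eq_zero_iff_eq_neg]⟩

theorem eq_zeroSet_normalVec {K : AffineSubspace ℝ V} (h : IsHyperplane K) :
    K = zeroSet (normalVec K) := by
  ext x
  rw [(hasEquation_normalVec h).2, mem_zeroSet, add_eq_zero_iff_eq_neg]

theorem zeroSet_smul {c : ℝ} (hc : c ≠ 0) (φ : Dual ℝ V × ℝ) : zeroSet (c • φ) = zeroSet φ := by
  ext x
  simp [← mul_add, hc]

theorem passesThroughInter_iff [FiniteDimensional ℝ V] {K : AffineSubspace ℝ V}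
    {S : Finset (AffineSubspace ℝ V)} :
    PassesThroughInter K S ↔ normalVec K ∈ spanOn normalVec S := by
  rw [spanOn, mem_span_iff_linearForm, PassesThroughInter, SetLike.le_def]
  simp [semicone_eq_ker, Submodule.mem_iInf]

theorem vo_eq [FiniteDimensional ℝ V] {A : Finset (AffineSubspace ℝ V)} {m : ℕ} (hm : 1 ≤ m)
    {p : Fin m → V} {y : Finset (AffineSubspace ℝ V) → Dual ℝ V × ℝ}
    (hy : ∀ S ∈ A.powersetCard (m + 1), spanOn normalVec S ⊓ vanishing p = ℝ ∙ y S) :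
    vo A p = {K | ∃ S ∈ A.powersetCard (m + 1), y S ≠ 0 ∧ K = zeroSet (y S)} := by
  ext K
  constructor
  · rintro ⟨hK, hpK, S, hSA, hS, hKS⟩
    have hS' := Finset.mem_powersetCard.2 ⟨hSA, hS⟩
    have hmem : normalVec K ∈ spanOn normalVec S ⊓ vanishing p := by
      refine ⟨passesThroughInter_iff.1 hKS, mem_vanishing.2 fun k => ?_⟩
      rw [← mem_zeroSet, ← eq_zeroSet_normalVec hK]
      exact hpK k
    rw [hy S hS'] at hmem
    obtain ⟨c, hc⟩ := Submodule.mem_span_singleton.1 hmem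
    have hne : c • y S ≠ 0 := by
      rw [hc]
      exact fun h => (hasEquation_normalVec hK).1 (by rw [h]; rfl)
    rw [smul_ne_zero_iff] at hne
    refine ⟨S, hS', hne.2, ?_⟩
    rw [eq_zeroSet_normalVec hK, ← hc, zeroSet_smul hne.1]
  · rintro ⟨S, hS, hyS, rfl⟩
    have hmem : y S ∈ spanOn normalVec S ⊓ vanishing p := by
      rw [hy S hS]
      exact Submodule.mem_span_singleton_self _
    have hv := mem_vanishing.1 hmem.2
    -- A constant function vanishing at a point is zero. This excludes the hyperplane at infinity
    -- and uses that there is at least one point.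
    have h1 : (y S).1 ≠ 0 := by
      intro h1
      have := hv ⟨0, hm⟩
      rw [h1, LinearMap.zero_apply, zero_add] at this
      exact hyS (Prod.ext h1 this)
    have heq := hasEquation_zeroSet h1
    rw [Finset.mem_powersetCard] at hS
    refine ⟨⟨_, _, heq⟩, hv, S, hS.1, hS.2, ?_⟩
    rintro ⟨x, t⟩ hxt
    rw [mem_semicone_iff heq]
    have h2 := (mem_span_iff_linearForm _ _).1 hmem.1 (x, t) (by
      rintro _ ⟨H, hH, rfl⟩
      have : (x, t) ∈ semicone H := by
        simp only [Submodule.mem_iInf] at hxt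
        exact hxt H hH
      exact this)
    rw [linearForm_apply] at h2
    linarith

/-- The intersection lattice of a central arrangement is the lattice of flats of its linear
matroid. -/
theorem nonempty_intersectionLattice_orderIso [FiniteDimensional ℝ V] {β : Type*}
    (y : β → Dual ℝ V × ℝ) (E : Set β) (q : V) (hq : ∀ e ∈ E, q ∈ zeroSet (y e)) :
    Nonempty (IntersectionLattice {K | ∃ e ∈ E, y e ≠ 0 ∧ K = zeroSet (y e)} ≃o
      LatticeOfFlats (linearMatroid (K := ℝ) y E)) := by
  let B : Set (AffineSubspace ℝ V) := {K | ∃ e ∈ E, y e ≠ 0 ∧ K = zeroSet (y e)}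
  -- These two order-reversing maps become mutually inverse on intersections and flats. Loops `y e =
  -- 0` belong to every flat and do not affect intersections.
  let flat : AffineSubspace ℝ V → Set β := fun X => {e ∈ E | X ≤ zeroSet (y e)}
  let inter : Set β → AffineSubspace ℝ V := fun F => sInf {K | ∃ e ∈ F, y e ≠ 0 ∧ K = zeroSet (y e)}
  have hzero : ∀ e ∈ E, y e = 0 → ∀ x, x ∈ zeroSet (y e) := by
    intro e _ h x
    simp [h]
  have mem_inter : ∀ F ⊆ E, ∀ x, x ∈ inter F ↔ ∀ e ∈ F, x ∈ zeroSet (y e) := by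
    intro F hF x
    rw [AffineSubspace.mem_sInf_iff]
    constructor
    · intro h e he
      by_cases h0 : y e = 0
      · exact hzero e (hF he) h0 x
      · exact h _ ⟨e, he, h0, rfl⟩
    · rintro h _ ⟨e, he, -, rfl⟩
      exact h e he
  have isFlat : ∀ X, (linearMatroid (K := ℝ) y E).IsFlat (flat X) := by
    intro X
    refine isFlat_linearMatroid.2 ⟨fun e he => he.1, fun e he hspan => ⟨he, fun x hx => ?_⟩⟩
    have := (mem_span_iff_linearForm _ _).1 hspan (x, 1) (by
      rintro _ ⟨f, hf, rfl⟩
      have := mem_zeroSet.1 (hf.2 hx)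
      simpa using this)
    simpa using this
  have flat_inter : ∀ F, (linearMatroid (K := ℝ) y E).IsFlat F → flat (inter F) = F := by
    intro F hF
    obtain ⟨hFE, hF⟩ := isFlat_linearMatroid.1 hF
    refine Set.Subset.antisymm (fun e he => hF e he.1 ?_)
      fun e he => ⟨hFE he, fun x hx => (mem_inter F hFE x).1 hx e he⟩
    rw [mem_span_iff_linearForm]
    rintro ⟨x, t⟩ hxt
    -- shift by a multiple of `q` to get a point at height `1`
    have h1 := mem_zeroSet.1 (he.2 ((mem_inter F hFE (x + (1 - t) • q)).2 fun f hf => by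
      have h2 := mem_zeroSet.1 (hq f (hFE hf))
      have h3 := hxt _ ⟨f, hf, rfl⟩
      rw [linearForm_apply] at h3
      rw [mem_zeroSet, map_add, map_smul, smul_eq_mul]
      linear_combination h3 + (1 - t) * h2))
    have h2 := mem_zeroSet.1 (hq e he.1)
    rw [map_add, map_smul, smul_eq_mul] at h1
    rw [linearForm_apply]
    linear_combination h1 - (1 - t) * h2
  have inter_flat : ∀ X, (∃ C ⊆ B, X = sInf C) → inter (flat X) = X := by
    rintro _ ⟨C, hC, rfl⟩
    refine le_antisymm (le_sInf fun K hK => ?_)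
      fun x hx => (mem_inter _ (fun e he => he.1) x).2 fun e he => he.2 hx
    obtain ⟨e, he, -, rfl⟩ := hC hK
    exact fun x hx => (mem_inter _ (fun e he => he.1) x).1 hx e ⟨he, sInf_le hK⟩
  have inter_mem : ∀ F ⊆ E, inter F ≠ ⊥ ∧ ∃ C ⊆ B, inter F = sInf C := by
    intro F hF
    refine ⟨fun h => ?_, _, ?_, rfl⟩
    · have : q ∈ inter F := (mem_inter F hF q).2 fun e he => hq e (hF he)
      rw [h] at this
      exact AffineSubspace.notMem_bot ℝ V q this
    · rintro _ ⟨e, he, h⟩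
      exact ⟨e, hF he, h⟩
  refine ⟨{
    toFun := fun X => ⟨flat (OrderDual.ofDual X).1, isFlat _⟩
    invFun := fun F => OrderDual.toDual ⟨inter F.1, inter_mem F.1 F.2.subset_ground⟩
    left_inv := fun X => congrArg OrderDual.toDual
      (Subtype.ext (inter_flat _ (OrderDual.ofDual X).2.2))
    right_inv := fun F => Subtype.ext (flat_inter F.1 F.2)
    map_rel_iff' := fun {X Y} => ?_ }⟩
  change flat (OrderDual.ofDual X).1 ⊆ flat (OrderDual.ofDual Y).1 ↔
    (OrderDual.ofDual Y).1 ≤ (OrderDual.ofDual X).1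
  refine ⟨fun h => ?_, fun h e he => ⟨he.1, h.trans he.2⟩⟩
  rw [← inter_flat _ (OrderDual.ofDual X).2.2]
  exact fun x hx => (mem_inter _ (fun e he => he.1) x).2 fun e he => (h he).2 hx

end Arrangements

end ValidOrder

end

/-! ### The theorem -/

theorem mainTheorem11 {V : Type*} [AddCommGroup V] [Module ℝ V] [FiniteDimensional ℝ V]
    (A : Finset (AffineSubspace ℝ V)) (hA : ∀ H ∈ A, ValidOrder.IsHyperplane H)
    (m : ℕ) (hm : 1 ≤ m) :
    ValidOrder.ForGenericPoints (V := V) m fun p =>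
      Nonempty (ValidOrder.IntersectionLattice (ValidOrder.vo A p) ≃o
        ValidOrder.LatticeOfFlats
          (ValidOrder.dilworthTruncation m (ValidOrder.arrangementMatroid A))) := by
  refine (ValidOrder.forGenericPoints_inGeneralPosition ValidOrder.normalVec A hm).mono
    fun p hp => ?_
  obtain ⟨y, hy, hM⟩ := ValidOrder.exists_dilworthTruncation_eq_linearMatroid hp
  rw [ValidOrder.arrangementMatroid, hM, ValidOrder.vo_eq hm hy]
  refine ValidOrder.nonempty_intersectionLattice_orderIso y _ (p ⟨0, hm⟩) fun S hS => ?_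
  have : y S ∈ ValidOrder.spanOn ValidOrder.normalVec S ⊓ ValidOrder.vanishing p := by
    rw [hy S hS]
    exact Submodule.mem_span_singleton_self _
  exact ValidOrder.mem_vanishing.1 this.2 ⟨0, hm⟩
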